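/- Let $\omega=(\sqrt5-1)/2$ and let $(F_n)_{n\ge 0}=(0,1,1,2,3,5,8,\dots)$ be the Fibonacci sequence ($F_0=0$, $F_1=1$, $F_{n+2}=F_{n+1}+F_n$). There are real constants $C_1,C_2$ with $0<C_1\le 1\le C_2$ such that, for every integer $n\ge 2$ and every real $\alpha$ with $|\alpha|\le\omega^{n+1}$, $$C_1\le\prod_{r=1}^{F_n}\bigl|2\sin\pi(r\omega+\alpha)\bigr|\le C_2 .$$ -/

import Mathlib

/-- The inverse golden mean `ω = (√5 - 1) / 2`. -/
noncomputable def invGoldenMean : ℝ := (Real.sqrt 5 - 1) / 2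

/-- The shifted sine product `∏_{r=1}^{k} |2 sin π(rω + α)|` at the inverse golden mean `ω`. -/
noncomputable def shiftedSineProd (k : ℕ) (α : ℝ) : ℝ :=
  ∏ r ∈ Finset.Icc 1 k, |2 * Real.sin (Real.pi * ((r : ℝ) * invGoldenMean + α))|

open Finset

/-! Put N = F_n, p = F_{n-1}, η = ω^n. Since Nω = p ± η and p² ≡ ±1 mod N, the reordering r ≡ (j+1)p
mod N of the factors r < N turns rω + α, up to sign and integers, into (j+1)/N + B - η y_j, where B
is a constant and y_j = {(j+1)p/N} - 1/2 (`abs_sin_fib_rotation`). The unperturbed product ∏ 2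
sin(π(j+1)/N) is N. As y is odd under j+1 ↦ N-(j+1), multiplying each factor by its mirror image
removes B to first order. The log of the squared product over N² is then a linear term, a multiple
of η ∑ cot(π(j+1)/N) y_j, plus errors dominated by ∑ 1/l², l being the distance to the nearer end
(`sin_mul_sin_div_sq_bounds`). The linear term needs cancellation: partial sums of y are O(√m)
(`abs_sum_fract_fib_le`), and Abel summation gives O(N) for the cotangent sum
(`abs_sum_cot_mul_fract_le`), which η = O(1/N) makes bounded. So the factors r < N multiply to order
N, and the factor r = N has order ω^n, that is 1/N. -/

/-! ### Fibonacci numbers against powers of ω. -/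

theorem invGoldenMean_sq : invGoldenMean ^ 2 = 1 - invGoldenMean := by
  have h : Real.sqrt 5 ^ 2 = 5 := Real.sq_sqrt (by norm_num)
  unfold invGoldenMean
  linear_combination h / 4

theorem invGoldenMean_gt : 0.618 < invGoldenMean := by
  have : (2.236 : ℝ) < Real.sqrt 5 := Real.lt_sqrt_of_sq_lt (by norm_num)
  unfold invGoldenMean
  linarith

theorem invGoldenMean_lt : invGoldenMean < 0.6181 := by
  have : Real.sqrt 5 < (2.2362 : ℝ) := (Real.sqrt_lt' (by norm_num)).2 (by norm_num)
  unfold invGoldenMean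
  linarith

theorem invGoldenMean_pos : 0 < invGoldenMean := by linarith [invGoldenMean_gt]

theorem fib_succ_mul_invGoldenMean (k : ℕ) :
    (Nat.fib (k + 1) : ℝ) * invGoldenMean = Nat.fib k - (-invGoldenMean) ^ (k + 1) := by
  induction k with
  | zero => simp
  | succ k ih =>
    rw [Nat.fib_add_two, pow_succ]
    push_cast
    have h := invGoldenMean_sq
    have e : (Nat.fib (k + 1) : ℝ) * invGoldenMean ^ 2 =
        Nat.fib k * invGoldenMean - (-invGoldenMean) ^ (k + 1) * invGoldenMean := by
      linear_combination invGoldenMean * ih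
    rw [h] at e
    linear_combination -e

/-- As ω² + ω = 1, each term is a convex combination of the previous two, so bounds on the first two
terms (ω and 2ω²) persist. That 0.8 is below 1 later keeps every sine away from its zeros. -/
theorem fib_succ_mul_pow_le (k : ℕ) :
    (Nat.fib (k + 2) : ℝ) * invGoldenMean ^ (k + 1) ≤ 0.8 := by
  have h := invGoldenMean_sq
  have h1 := invGoldenMean_gt
  have h2 := invGoldenMean_lt
  have h0 := invGoldenMean_pos
  induction k using Nat.twoStepInduction with
  | zero => norm_num; linarith
  | one =>
    norm_num [Nat.fib_add_two, h]; linarith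
  | more k ih1 ih2 =>
    have e : (Nat.fib (k + 4) : ℝ) * invGoldenMean ^ (k + 3) =
        invGoldenMean ^ 2 * (Nat.fib (k + 2) * invGoldenMean ^ (k + 1)) +
        invGoldenMean * (Nat.fib (k + 3) * invGoldenMean ^ (k + 2)) := by
      rw [Nat.fib_add_two (n := k + 2)]; push_cast; ring
    rw [show k + 2 + 2 = k + 4 by rfl, show k + 2 + 1 = k + 3 by rfl, e, h]
    have := mul_le_mul_of_nonneg_left ih1 (show 0 ≤ 1 - invGoldenMean by linarith)
    have := mul_le_mul_of_nonneg_left ih2 h0.le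
    linarith

theorem fib_succ_mul_pow_ge (k : ℕ) :
    invGoldenMean ≤ (Nat.fib (k + 2) : ℝ) * invGoldenMean ^ (k + 1) := by
  have h := invGoldenMean_sq
  have h1 := invGoldenMean_gt
  have h2 := invGoldenMean_lt
  have h0 := invGoldenMean_pos
  induction k using Nat.twoStepInduction with
  | zero => norm_num
  | one =>
    norm_num [Nat.fib_add_two, h]; linarith
  | more k ih1 ih2 =>
    have e : (Nat.fib (k + 4) : ℝ) * invGoldenMean ^ (k + 3) =
        invGoldenMean ^ 2 * (Nat.fib (k + 2) * invGoldenMean ^ (k + 1)) +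
        invGoldenMean * (Nat.fib (k + 3) * invGoldenMean ^ (k + 2)) := by
      rw [Nat.fib_add_two (n := k + 2)]; push_cast; ring
    rw [show k + 2 + 2 = k + 4 by rfl, show k + 2 + 1 = k + 3 by rfl, e, h]
    have := mul_le_mul_of_nonneg_left ih1 (show 0 ≤ 1 - invGoldenMean by linarith)
    have := mul_le_mul_of_nonneg_left ih2 h0.le
    linarith

theorem fib_sq_add_mul_sub_sq (k : ℕ) :
    (Nat.fib k : ℤ) ^ 2 + Nat.fib k * Nat.fib (k + 1) - (Nat.fib (k + 1) : ℤ) ^ 2 =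
      (-1) ^ (k + 1) := by
  induction k with
  | zero => simp
  | succ k ih =>
    rw [Nat.fib_add_two, pow_succ _ (k + 1), ← ih]
    push_cast
    ring

/-- Both fractions are compared with ω; the constant is 1 because (1 + ω)ω = 1. -/
theorem abs_fib_div_fib_sub_le {n k : ℕ} (h : k ≤ n) :
    |(Nat.fib n : ℝ) / Nat.fib (n + 1) - Nat.fib k / Nat.fib (k + 1)| ≤
      1 / (Nat.fib (k + 1) : ℝ) ^ 2 := by
  have hw := invGoldenMean_pos
  have hw2 := invGoldenMean_lt
  have pos : ∀ i, (0 : ℝ) < Nat.fib (i + 1) := fun i => by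
    exact_mod_cast Nat.fib_pos.2 (Nat.succ_pos i)
  have key : ∀ i, |(Nat.fib i : ℝ) / Nat.fib (i + 1) - invGoldenMean| =
      invGoldenMean ^ (i + 1) / Nat.fib (i + 1) := by
    intro i
    have : (Nat.fib i : ℝ) / Nat.fib (i + 1) - invGoldenMean =
        (-invGoldenMean) ^ (i + 1) / Nat.fib (i + 1) := by
      rw [sub_eq_iff_eq_add, div_add' _ _ _ (pos i).ne', mul_comm invGoldenMean,
        fib_succ_mul_invGoldenMean]
      ring
    rw [this, abs_div, abs_pow, abs_neg, abs_of_pos hw, abs_of_pos (pos i)]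
  have half : ∀ i, (Nat.fib (i + 1) : ℝ) * invGoldenMean ^ (i + 1) ≤ invGoldenMean := by
    intro i
    cases i with
    | zero => norm_num
    | succ i =>
      have := mul_le_mul_of_nonneg_right (fib_succ_mul_pow_le i) hw.le
      rw [mul_assoc, ← pow_succ] at this
      linarith
  rcases h.eq_or_lt with rfl | hlt
  · simp
  · obtain ⟨m, rfl⟩ := Nat.exists_eq_add_of_lt hlt
    have hle : (Nat.fib (k + 1) : ℝ) ≤ Nat.fib (k + m + 1 + 1) := by
      exact_mod_cast Nat.fib_mono (by omega)
    have h2 : invGoldenMean ^ (k + m + 1 + 1) ≤ invGoldenMean * invGoldenMean ^ (k + 1) := by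
      rw [← pow_succ']
      exact pow_le_pow_of_le_one hw.le (by linarith) (by omega)
    have h3 : invGoldenMean ^ (k + m + 1 + 1) / (Nat.fib (k + m + 1 + 1) : ℝ) ≤
        invGoldenMean * invGoldenMean ^ (k + 1) / Nat.fib (k + 1) :=
      div_le_div₀ (by positivity) h2 (pos k) hle
    calc _ = |((Nat.fib (k + m + 1) : ℝ) / Nat.fib (k + m + 1 + 1) - invGoldenMean) -
          (Nat.fib k / Nat.fib (k + 1) - invGoldenMean)| := by ring_nf
      _ ≤ _ := abs_sub _ _
      _ ≤ invGoldenMean * invGoldenMean ^ (k + 1) / Nat.fib (k + 1) +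
          invGoldenMean ^ (k + 1) / Nat.fib (k + 1) := by
        rw [key, key]; gcongr
      _ = (1 + invGoldenMean) * (Nat.fib (k + 1) * invGoldenMean ^ (k + 1)) /
          (Nat.fib (k + 1) : ℝ) ^ 2 := by
        have := (pos k).ne'
        field_simp
        ring
      _ ≤ _ := by
        gcongr
        have := mul_le_mul_of_nonneg_left (half k) (show 0 ≤ 1 + invGoldenMean by linarith)
        linarith [invGoldenMean_sq]

/-- Modulus of ∏ (1 - ζ^i) = M + 1 for a primitive root ζ, with |1 - e^{2ix}| = 2 sin x. -/
theorem prod_two_sin (M : ℕ) :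
    ∏ k ∈ range M, (2 * Real.sin (Real.pi * (k + 1) / (M + 1))) = M + 1 := by
  have hp : IsPrimitiveRoot (Complex.exp (2 * Real.pi * Complex.I / ((M + 1 : ℕ) : ℂ))) (M + 1) :=
    Complex.isPrimitiveRoot_exp _ (by omega)
  have h := congrArg norm hp.prod_one_sub_pow_eq_order
  rw [norm_prod] at h
  have e : ‖((M : ℂ) + 1)‖ = M + 1 := by
    rw [show (M : ℂ) + 1 = ((M + 1 : ℕ) : ℂ) by push_cast; rfl, Complex.norm_natCast]
    push_cast; rfl
  rw [e] at h
  refine Eq.trans ?_ h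
  refine prod_congr rfl fun k hk => ?_
  have hk : (k : ℝ) + 1 ≤ M := by exact_mod_cast mem_range.1 hk
  rw [← Complex.exp_nat_mul, norm_sub_rev]
  have h2 := Complex.norm_exp_I_mul_ofReal_sub_one (2 * (Real.pi * (k + 1) / (M + 1)))
  rw [show (((k + 1 : ℕ) : ℂ)) * (2 * Real.pi * Complex.I / ((M + 1 : ℕ) : ℂ)) =
    Complex.I * ((2 * (Real.pi * (k + 1) / (M + 1)) : ℝ) : ℂ) by push_cast; ring, h2,
    mul_div_cancel_left₀ _ two_ne_zero, Real.norm_of_nonneg]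
  refine mul_nonneg zero_le_two (Real.sin_nonneg_of_nonneg_of_le_pi ?_ ?_)
  · positivity
  rw [div_le_iff₀ (by positivity)]
  exact mul_le_mul_of_nonneg_left (by linarith) Real.pi_pos.le

/-! ### Sawtooth sums along rotations. -/

/-- Multiplication by a permutes the residues mod q, so the points are (i + t)/q for 0 ≤ i < q, with
t = {qβ}. -/
theorem sum_fract_mul_div_add {q a : ℕ} (hq : 0 < q) (h : a.Coprime q) (β : ℝ) :
    ∑ j ∈ range q, Int.fract ((j : ℝ) * (a / q) + β) = Int.fract (q * β) + (q - 1) / 2 := by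
  have hq' : (0 : ℝ) < q := by exact_mod_cast hq
  have hqz : (0 : ℤ) < q := by exact_mod_cast hq
  set b : ℤ := ⌊q * β⌋ with hb
  set t : ℝ := Int.fract (q * β) with ht
  have hbt : (q : ℝ) * β = b + t := (Int.floor_add_fract _).symm
  let f : ℕ → ℕ := fun j => (((j : ℤ) * a + b) % q).toNat
  have hf : ∀ j, (f j : ℤ) = ((j : ℤ) * a + b) % q := fun j =>
    Int.toNat_of_nonneg (Int.emod_nonneg _ hqz.ne')
  have hlt : ∀ j, f j < q := fun j => by
    have := Int.emod_lt_of_pos ((j : ℤ) * a + b) hqz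
    rw [← hf] at this
    exact_mod_cast this
  have inj : Set.InjOn f (range q) := by
    intro i hi j hj hij
    have hij' : ((i : ℤ) * a + b) % q = ((j : ℤ) * a + b) % q := by rw [← hf, ← hf, hij]
    have h1 : (i : ℤ) * a ≡ j * a [ZMOD q] := Int.ModEq.add_right_cancel' b hij'
    have h2 : i * a ≡ j * a [MOD q] := by
      rw [← Int.natCast_modEq_iff]; exact_mod_cast h1
    have h3 : i ≡ j [MOD q] := Nat.ModEq.cancel_right_of_coprime h.symm h2
    exact h3.eq_of_lt_of_lt (by simpa using hi) (by simpa using hj)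
  have img : (range q).image f = range q := by
    apply eq_of_subset_of_card_le
    · intro i hi
      obtain ⟨j, -, rfl⟩ := mem_image.1 hi
      exact mem_range.2 (hlt j)
    · rw [card_image_of_injOn inj]
  have term : ∀ j : ℕ, Int.fract ((j : ℝ) * (a / q) + β) = ((f j : ℝ) + t) / q := by
    intro j
    rw [Int.fract_eq_iff]
    have h0 : 0 ≤ t := Int.fract_nonneg _
    have h1 : t < 1 := Int.fract_lt_one _
    have h2 : (f j : ℝ) + 1 ≤ q := by exact_mod_cast hlt j
    refine ⟨by positivity, ?_, ((j : ℤ) * a + b) / q, ?_⟩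
    · rw [div_lt_one hq']; linarith
    · have h3 : (f j : ℝ) + q * (((j : ℤ) * a + b) / q : ℤ) = j * a + b := by
        have := Int.emod_add_mul_ediv ((j : ℤ) * a + b) q
        rw [← hf] at this
        exact_mod_cast this
      field_simp
      linear_combination hbt - h3
  simp_rw [term]
  have hs : ∑ j ∈ range q, (f j : ℝ) = q * (q - 1) / 2 := by
    rw [← sum_image (f := fun i : ℕ => (i : ℝ)) inj, img]
    clear * -
    induction q with
    | zero => simp
    | succ n ih => rw [sum_range_succ, ih]; push_cast; ring
  rw [← sum_div, sum_add_distrib, hs]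
  simp
  field_simp
  ring

/-- A Denjoy–Koksma bound. Replacing x by a/q moves each point by at most 1/q; shifting β by 1/q
makes the floors comparable, at a cost of 2/q per term. The total is 2, plus 1/2 from the exact
rational sum. -/
theorem abs_sum_fract_sub_half_le {q a : ℕ} (hq : 0 < q) (h : a.Coprime q) {x : ℝ}
    (hx : |x - a / q| ≤ 1 / (q : ℝ) ^ 2) (β : ℝ) :
    |∑ j ∈ range q, (Int.fract ((j : ℝ) * x + β) - 1 / 2)| ≤ 5 / 2 := by
  have hq' : (0 : ℝ) < q := by exact_mod_cast hq
  have near : ∀ j ∈ range q, |(j : ℝ) * x - j * (a / q)| ≤ 1 / q := by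
    intro j hj
    have hj : (j : ℝ) ≤ q := by exact_mod_cast (mem_range.1 hj).le
    rw [← mul_sub, abs_mul, Nat.abs_cast]
    calc (j : ℝ) * |x - a / q| ≤ q * (1 / (q : ℝ) ^ 2) := by gcongr
      _ = 1 / q := by field_simp
  have up : ∀ j ∈ range q, Int.fract ((j : ℝ) * x + β) ≤
      Int.fract ((j : ℝ) * (a / q) + (β - 1 / q)) + 2 / q := by
    intro j hj
    have h1 := abs_le.1 (near j hj)
    have h2 : ⌊(j : ℝ) * (a / q) + (β - 1 / q)⌋ ≤ ⌊(j : ℝ) * x + β⌋ :=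
      Int.floor_mono (by linarith)
    have h2 : (⌊(j : ℝ) * (a / q) + (β - 1 / q)⌋ : ℝ) ≤ ⌊(j : ℝ) * x + β⌋ := by exact_mod_cast h2
    rw [Int.fract, Int.fract]
    have : (2 : ℝ) / q = 1 / q + 1 / q := by ring
    linarith
  have lo : ∀ j ∈ range q, Int.fract ((j : ℝ) * (a / q) + (β + 1 / q)) - 2 / q ≤
      Int.fract ((j : ℝ) * x + β) := by
    intro j hj
    have h1 := abs_le.1 (near j hj)
    have h2 : ⌊(j : ℝ) * x + β⌋ ≤ ⌊(j : ℝ) * (a / q) + (β + 1 / q)⌋ :=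
      Int.floor_mono (by linarith)
    have h2 : (⌊(j : ℝ) * x + β⌋ : ℝ) ≤ ⌊(j : ℝ) * (a / q) + (β + 1 / q)⌋ := by exact_mod_cast h2
    rw [Int.fract, Int.fract]
    have : (2 : ℝ) / q = 1 / q + 1 / q := by ring
    linarith
  have hup := sum_le_sum up
  have hlo := sum_le_sum lo
  rw [sum_add_distrib, sum_fract_mul_div_add hq h] at hup
  rw [sum_sub_distrib, sum_fract_mul_div_add hq h] at hlo
  have c : ∑ _j ∈ range q, (2 : ℝ) / q = 2 := by
    rw [sum_const, card_range, nsmul_eq_mul]; field_simp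
  rw [c] at hup hlo
  rw [sum_sub_distrib, sum_const, card_range, nsmul_eq_mul, abs_le]
  have h1 := Int.fract_lt_one ((q : ℝ) * (β - 1 / q))
  have h2 := Int.fract_nonneg ((q : ℝ) * (β + 1 / q))
  constructor <;> linarith

/-- Blocks of Fibonacci length are peeled off greedily, each costing 5/2. The square root is crude,
but any exponent below 1 suffices for the Abel summation. -/
theorem abs_sum_fract_fib_le (n : ℕ) (m : ℕ) (hm : m ≤ Nat.fib (n + 1)) (β : ℝ) :
    |∑ j ∈ range m, (Int.fract ((j : ℝ) * (Nat.fib n / Nat.fib (n + 1)) + β) - 1 / 2)| ≤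
      9 * √(m : ℝ) := by
  induction m using Nat.strong_induction_on generalizing β with
  | _ m ih =>
  rcases Nat.eq_zero_or_pos m with rfl | hpos
  · simp
  obtain ⟨k, hk1, hk2, hkn⟩ : ∃ k, Nat.fib (k + 1) ≤ m ∧ m ≤ 2 * Nat.fib (k + 1) ∧ k ≤ n := by
    have h1 := Nat.fib_greatestFib_le m
    have h2 := Nat.lt_fib_greatestFib_add_one m
    have h3 : 2 ≤ Nat.greatestFib m := Nat.le_greatestFib.2 (by rw [Nat.fib_two]; exact hpos)
    obtain ⟨k, hk⟩ : ∃ k, Nat.greatestFib m = k + 2 := ⟨_, (Nat.sub_add_cancel h3).symm⟩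
    rw [hk] at h1 h2
    have h4 : Nat.fib (k + 1) ≤ Nat.fib (k + 2) := Nat.fib_mono (by omega)
    have h5 : Nat.fib (k + 2 + 1) = Nat.fib (k + 1) + Nat.fib (k + 2) := Nat.fib_add_two
    by_cases hkn : k + 1 ≤ n
    · exact ⟨k + 1, h1, by change m ≤ 2 * Nat.fib (k + 2); omega, hkn⟩
    -- Here F_{n+1} ≤ F_{k+1} ≤ F_{k+2} ≤ m ≤ F_{n+1}, so one block is everything.
    · have h6 : Nat.fib (n + 1) ≤ Nat.fib (k + 1) := Nat.fib_mono (by omega)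
      exact ⟨n, by omega, by omega, le_rfl⟩
  have qpos : 0 < Nat.fib (k + 1) := Nat.fib_pos.2 (by omega)
  set q := Nat.fib (k + 1) with hq
  obtain ⟨l, rfl⟩ := Nat.exists_eq_add_of_le hk1
  rw [sum_range_add]
  have b1 := abs_sum_fract_sub_half_le qpos (Nat.fib_coprime_fib_succ k)
    (abs_fib_div_fib_sub_le hkn) β
  have b2 := ih l (by omega) (by omega) (β + q * (Nat.fib n / Nat.fib (n + 1)))
  have e : ∀ j : ℕ, ((q + j : ℕ) : ℝ) * ((Nat.fib n : ℝ) / Nat.fib (n + 1)) + β =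
      j * (Nat.fib n / Nat.fib (n + 1)) + (β + q * (Nat.fib n / Nat.fib (n + 1))) := by
    intro j; push_cast; ring
  simp_rw [e]
  refine (abs_add_le _ _).trans ((add_le_add b1 b2).trans ?_)
  have q1 : (1 : ℝ) ≤ q := by exact_mod_cast qpos
  have hl : (l : ℝ) ≤ q := by exact_mod_cast (by omega : l ≤ q)
  push_cast
  set s := √(l : ℝ)
  have hs : s ^ 2 = l := Real.sq_sqrt (by positivity)
  have hs0 : 0 ≤ s := Real.sqrt_nonneg _
  -- 5/18 is the block cost 5/2 divided by 9.
  have : s + 5 / 18 ≤ √((q : ℝ) + l) := by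
    apply Real.le_sqrt_of_sq_le
    have : 0 ≤ (q : ℝ) := by linarith
    nlinarith [sq_nonneg (s - 1)]
  linarith

/-! ### Perturbation of sines. -/

theorem mul_sin_le_sin_mul {t x : ℝ} (ht0 : 0 ≤ t) (ht1 : t ≤ 1) (hx0 : 0 ≤ x)
    (hx1 : x ≤ Real.pi) : t * Real.sin x ≤ Real.sin (t * x) := by
  have h0 : (0 : ℝ) ∈ Set.Icc 0 Real.pi := ⟨le_rfl, Real.pi_pos.le⟩
  have h1 : x ∈ Set.Icc 0 Real.pi := ⟨hx0, hx1⟩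
  have := strictConcaveOn_sin_Icc.concaveOn.2 h0 h1 (sub_nonneg.2 ht1) ht0 (by ring)
  simpa using this

/-- By concavity, covering at most a fraction θ of the way to an endpoint of [0, π] loses at most
that fraction of the sine. -/
theorem mul_sin_le_sin_add {θ a s : ℝ} (hθ1 : θ ≤ 1) (ha0 : 0 < a) (ha1 : a < Real.pi)
    (h1 : |s| ≤ θ * a) (h2 : |s| ≤ θ * (Real.pi - a)) :
    (1 - θ) * Real.sin a ≤ Real.sin (a + s) := by
  have hs := Real.sin_pos_of_pos_of_lt_pi ha0 ha1
  rcases le_total s 0 with h | h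
  · rw [abs_of_nonpos h] at h1
    have e : a + s = (1 - -s / a) * a := by field_simp; ring
    have h3 : -s / a ≤ θ := by rwa [div_le_iff₀ ha0]
    have h4 : 0 ≤ -s / a := div_nonneg (by linarith) ha0.le
    rw [e]
    refine le_trans ?_ (mul_sin_le_sin_mul (by linarith) (by linarith) ha0.le ha1.le)
    exact mul_le_mul_of_nonneg_right (by linarith) hs.le
  · rw [abs_of_nonneg h] at h2
    have hb : 0 < Real.pi - a := by linarith
    have e : Real.pi - (a + s) = (1 - s / (Real.pi - a)) * (Real.pi - a) := by field_simp; ring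
    have h3 : s / (Real.pi - a) ≤ θ := by rwa [div_le_iff₀ hb]
    have h4 : 0 ≤ s / (Real.pi - a) := div_nonneg h hb.le
    rw [← Real.sin_pi_sub (a + s), e, ← Real.sin_pi_sub a]
    rw [← Real.sin_pi_sub a] at hs
    refine le_trans ?_ (mul_sin_le_sin_mul (by linarith) (by linarith) hb.le (by linarith))
    exact mul_le_mul_of_nonneg_right (by linarith) hs.le

theorem abs_sin_sub_self_le (t : ℝ) : |Real.sin t - t| ≤ 2 * t ^ 2 := by
  wlog ht : 0 ≤ t generalizing t
  · have := this (-t) (by linarith)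
    rw [Real.sin_neg, ← abs_neg] at this
    calc _ = |-(-Real.sin t - -t)| := by ring_nf
      _ ≤ _ := this
      _ = _ := by ring
  rcases ht.eq_or_lt with rfl | ht
  · simp
  have h1 := Real.sin_lt ht
  rw [abs_of_nonpos (by linarith)]
  rcases le_total t 1 with h | h
  · have := Real.sin_gt_sub_cube ht
    nlinarith [mul_nonneg (sq_nonneg t) (sub_nonneg.2 h)]
  · have := Real.neg_one_le_sin t
    nlinarith

theorem two_mul_div_le_sin {l t N : ℝ} (hl : 0 ≤ l) (hN : 0 < N) (h1 : l ≤ t) (h2 : l ≤ N - t) :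
    2 * l / N ≤ Real.sin (Real.pi * t / N) := by
  have hpi := Real.pi_pos
  have key : ∀ u : ℝ, l ≤ u → 2 * u ≤ N → 2 * l / N ≤ Real.sin (Real.pi * u / N) := by
    intro u hu hu2
    have : 2 / Real.pi * (Real.pi * u / N) ≤ Real.sin (Real.pi * u / N) := by
      apply Real.mul_le_sin
      · have : 0 ≤ u := hl.trans hu
        positivity
      · rw [div_le_iff₀ hN]; nlinarith
    refine le_trans ?_ this
    rw [show 2 / Real.pi * (Real.pi * u / N) = 2 * u / N by field_simp]
    gcongr
  rcases le_total (2 * t) N with h | h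
  · exact key t h1 h
  · rw [← Real.sin_pi_sub, show Real.pi - Real.pi * t / N = Real.pi * (N - t) / N by field_simp]
    exact key _ h2 (by linarith)

/-- The shifts +c and -c cancel to first order, so the ratio R is 1 + 2b cot a up to O(s). Since R ≥
1/25, the lower bound passes to exponentials through log R ≥ 1 - 1/R. -/
theorem sin_mul_sin_div_sq_bounds {a b c : ℝ} (ha0 : 0 < a) (ha1 : a < Real.pi)
    (h1 : |b| + |c| ≤ 4 / 5 * a) (h2 : |b| + |c| ≤ 4 / 5 * (Real.pi - a)) :
    Real.exp (2 * b * (Real.cos a / Real.sin a) - 30000 * ((b ^ 2 + c ^ 2) / Real.sin a ^ 2)) ≤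
      Real.sin (a + b + c) * Real.sin (a + b - c) / Real.sin a ^ 2 ∧
    Real.sin (a + b + c) * Real.sin (a + b - c) / Real.sin a ^ 2 ≤
      Real.exp (2 * b * (Real.cos a / Real.sin a) + 30000 * ((b ^ 2 + c ^ 2) / Real.sin a ^ 2)) := by
  set S := Real.sin a with hS
  set K := Real.cos a with hK
  have hSpos : 0 < S := Real.sin_pos_of_pos_of_lt_pi ha0 ha1
  have hSK : S ^ 2 + K ^ 2 = 1 := Real.sin_sq_add_cos_sq a
  set R := Real.sin (a + b + c) * Real.sin (a + b - c) / S ^ 2 with hR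
  set s := (b ^ 2 + c ^ 2) / S ^ 2 with hs
  have hs0 : 0 ≤ s := by positivity
  have hs4 : s ≤ 4 := by
    have h3 : |b| + |c| ≤ 2 * S := by
      have := two_mul_div_le_sin (l := min a (Real.pi - a)) (t := a) (N := Real.pi)
        (le_min ha0.le (by linarith)) Real.pi_pos (min_le_left _ _) (min_le_right _ _)
      rw [mul_div_cancel_left₀ _ Real.pi_ne_zero, div_le_iff₀ Real.pi_pos, ← hS] at this
      have h4 : |b| + |c| ≤ 4 / 5 * min a (Real.pi - a) := by
        rcases min_choice a (Real.pi - a) with h | h <;> rw [h] <;> assumption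
      nlinarith [Real.pi_lt_four]
    rw [hs, div_le_iff₀ (by positivity), ← sq_abs b, ← sq_abs c]
    nlinarith [abs_nonneg b, abs_nonneg c]
  have hRlow : 1 / 25 ≤ R := by
    have e1 := mul_sin_le_sin_add (s := b + c) (by norm_num) ha0 ha1
      ((abs_add_le _ _).trans h1) ((abs_add_le _ _).trans h2)
    have e2 := mul_sin_le_sin_add (s := b - c) (by norm_num) ha0 ha1
      ((abs_sub _ _).trans h1) ((abs_sub _ _).trans h2)
    rw [← hS, ← add_assoc] at e1
    rw [← hS, ← add_sub_assoc] at e2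
    rw [hR, le_div_iff₀ (by positivity)]
    calc 1 / 25 * S ^ 2 = ((1 - 4 / 5) * S) * ((1 - 4 / 5) * S) := by ring
      _ ≤ _ := mul_le_mul e1 e2 (by positivity) (le_trans (by positivity) e1)
  have herr : |R - 1 - 2 * b * (K / S)| ≤ 10 * s := by
    -- From sin(x + c) sin(x - c) = sin² x - sin² c at x = a + b.
    have e : R - 1 - 2 * b * (K / S) = ((K ^ 2 - S ^ 2) * Real.sin b ^ 2 +
        S * K * (Real.sin (2 * b) - 2 * b) - Real.sin c ^ 2) / S ^ 2 := by
      rw [hR, Real.sin_sub (a + b), Real.sin_add (a + b), Real.sin_add, Real.cos_add, ← hS, ← hK,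
        Real.sin_two_mul]
      field_simp
      have hb := Real.sin_sq_add_cos_sq b
      have hc := Real.sin_sq_add_cos_sq c
      generalize Real.sin b = sb at *
      generalize Real.cos b = cb at *
      generalize Real.sin c = sc at *
      generalize Real.cos c = cc at *
      linear_combination (S * cb + K * sb) ^ 2 * hc - sc ^ 2 * (sb ^ 2 + cb ^ 2) * hSK -
        sc ^ 2 * hb + S ^ 2 * hb
    have b1 : |(K ^ 2 - S ^ 2) * Real.sin b ^ 2| ≤ b ^ 2 := by
      rw [abs_mul, abs_of_nonneg (sq_nonneg (Real.sin b))]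
      have : |K ^ 2 - S ^ 2| ≤ 1 := abs_le.2 ⟨by nlinarith, by nlinarith⟩
      calc _ ≤ 1 * Real.sin b ^ 2 := by gcongr
        _ ≤ _ := by rw [one_mul]; exact Real.sin_sq_le_sq
    have b2 : |S * K * (Real.sin (2 * b) - 2 * b)| ≤ 8 * b ^ 2 := by
      rw [abs_mul]
      have : |S * K| ≤ 1 := abs_le.2 ⟨by nlinarith [sq_nonneg (S + K)], by nlinarith [sq_nonneg (S - K)]⟩
      calc _ ≤ 1 * (2 * (2 * b) ^ 2) := by gcongr; exact abs_sin_sub_self_le _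
        _ = _ := by ring
    have b3 : Real.sin c ^ 2 ≤ c ^ 2 := Real.sin_sq_le_sq
    rw [e, abs_div, abs_of_pos (show 0 < S ^ 2 by positivity), hs, ← mul_div_assoc]
    gcongr
    have := abs_le.1 b1
    have := abs_le.1 b2
    have := sq_nonneg (Real.sin c)
    exact abs_le.2 ⟨by linarith [sq_nonneg b, sq_nonneg c], by linarith [sq_nonneg b, sq_nonneg c]⟩
  have hRpos : 0 < R := by linarith
  set v := 2 * b * (K / S) with hv
  have hv2 : v ^ 2 ≤ 4 * s := by
    rw [show v ^ 2 = 4 * (b ^ 2 * K ^ 2) / S ^ 2 by rw [hv]; ring, hs, ← mul_div_assoc]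
    apply div_le_div_of_nonneg_right _ (sq_nonneg S)
    nlinarith [sq_nonneg b, sq_nonneg c, mul_nonneg (sq_nonneg b) (sq_nonneg S)]
  -- 808 = 2(400 + 4). Together with 1/R ≤ 25 the total error is (10 + 808·25)s, below 30000 s.
  have hu2 : (R - 1) ^ 2 ≤ 808 * s := by
    have h3 : (R - 1 - v) ^ 2 ≤ 400 * s := by
      have := sq_le_sq' (abs_le.1 herr).1 (abs_le.1 herr).2
      nlinarith
    nlinarith [sq_nonneg (R - 1 - v - v)]
  obtain ⟨l1, l2⟩ := abs_le.1 herr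
  constructor
  · rw [← Real.le_log_iff_exp_le hRpos]
    refine le_trans ?_ (Real.one_sub_inv_le_log_of_pos hRpos)
    have h3 : 1 - R⁻¹ = (R - 1) - (R - 1) ^ 2 * R⁻¹ := by field_simp; ring
    have h4 : R⁻¹ ≤ 25 := by
      rw [inv_le_comm₀ hRpos (by norm_num)]; linarith
    have h5 : (R - 1) ^ 2 * R⁻¹ ≤ 808 * s * 25 := by gcongr
    linarith
  · have := Real.add_one_le_exp (v + 30000 * s)
    linarith

/-! ### The cotangent sum. -/

theorem exists_sum_sqrt_div_sq_le :
    ∃ Z : ℝ, ∀ n : ℕ, ∑ i ∈ range n, √((i + 1 : ℕ) : ℝ) / ((i + 1 : ℕ) : ℝ) ^ 2 ≤ Z := by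
  have h : Summable fun i : ℕ => 1 / (i : ℝ) ^ (3 / 2 : ℝ) :=
    Real.summable_one_div_nat_rpow.2 (by norm_num)
  have h' := (summable_nat_add_iff 1).2 h
  refine ⟨∑' i : ℕ, 1 / ((i + 1 : ℕ) : ℝ) ^ (3 / 2 : ℝ), fun n => ?_⟩
  refine le_trans (le_of_eq (sum_congr rfl fun i _ => ?_))
    (h'.sum_le_tsum (range n) fun i _ => by positivity)
  have hi : (0 : ℝ) < ((i + 1 : ℕ) : ℝ) := by positivity
  rw [Real.sqrt_eq_rpow, ← Real.rpow_natCast, ← Real.rpow_sub hi,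
    one_div (_ ^ (3 / 2 : ℝ)), ← Real.rpow_neg hi.le]
  norm_num

theorem sqrt_div_sq_min_le (a b : ℕ) :
    √((min a b : ℕ) : ℝ) / ((min a b : ℕ) : ℝ) ^ 2 ≤
      √(a : ℝ) / (a : ℝ) ^ 2 + √(b : ℝ) / (b : ℝ) ^ 2 := by
  have ha : 0 ≤ √(a : ℝ) / (a : ℝ) ^ 2 := by positivity
  have hb : 0 ≤ √(b : ℝ) / (b : ℝ) ^ 2 := by positivity
  rcases min_choice a b with h | h <;> rw [h] <;> linarith

theorem sum_sqrt_div_sq_min_le {Z : ℝ}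
    (hZ : ∀ n : ℕ, ∑ i ∈ range n, √((i + 1 : ℕ) : ℝ) / ((i + 1 : ℕ) : ℝ) ^ 2 ≤ Z) (n : ℕ) :
    ∑ i ∈ range n, √((min (i + 1) (n - i) : ℕ) : ℝ) / ((min (i + 1) (n - i) : ℕ) : ℝ) ^ 2 ≤
      2 * Z := by
  refine (sum_le_sum fun i _ => sqrt_div_sq_min_le _ _).trans ?_
  rw [sum_add_distrib, ← sum_range_reflect (fun i => √((n - i : ℕ) : ℝ) / ((n - i : ℕ) : ℝ) ^ 2)]
  have : ∑ j ∈ range n, √((n - (n - 1 - j) : ℕ) : ℝ) / ((n - (n - 1 - j) : ℕ) : ℝ) ^ 2 =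
      ∑ i ∈ range n, √((i + 1 : ℕ) : ℝ) / ((i + 1 : ℕ) : ℝ) ^ 2 := by
    refine sum_congr rfl fun j hj => ?_
    have := mem_range.1 hj
    rw [show n - (n - 1 - j) = j + 1 by omega]
  rw [this]
  linarith [hZ n]

theorem fract_sub_half_reflect {p M : ℕ} (h : p.Coprime (M + 1)) {j : ℕ} (hj : j < M) :
    Int.fract (((M - 1 - j : ℕ) + 1 : ℝ) * (p / (M + 1 : ℕ))) - 1 / 2 =
      -(Int.fract (((j : ℝ) + 1) * (p / (M + 1 : ℕ))) - 1 / 2) := by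
  have hN : ((M + 1 : ℕ) : ℝ) ≠ 0 := by positivity
  have hc : ((M - 1 - j : ℕ) : ℝ) + 1 = (M + 1 : ℕ) - ((j : ℝ) + 1) := by
    have : M - 1 - j + (j + 1) = M := by omega
    have : ((M - 1 - j : ℕ) : ℝ) + (j + 1) = M := by exact_mod_cast this
    push_cast
    linarith
  have e : ((M - 1 - j : ℕ) + 1 : ℝ) * (p / (M + 1 : ℕ)) =
      (p : ℕ) + -(((j : ℝ) + 1) * (p / (M + 1 : ℕ))) := by
    rw [hc]; field_simp
    ring
  have hne : Int.fract (((j : ℝ) + 1) * (p / (M + 1 : ℕ))) ≠ 0 := by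
    intro h0
    have h1 : ((j : ℝ) + 1) * (p / (M + 1 : ℕ)) = (((j + 1) * p : ℕ) : ℝ) / (M + 1 : ℕ) := by
      push_cast; ring
    rw [h1, Int.fract_div_natCast_eq_div_natCast_mod, div_eq_zero_iff] at h0
    have h2 : (j + 1) * p % (M + 1) = 0 := by
      rcases h0 with h0 | h0
      · exact_mod_cast h0
      · exact absurd h0 hN
    have h3 := h.symm.dvd_of_dvd_mul_right (Nat.dvd_of_mod_eq_zero h2)
    have := Nat.le_of_dvd (by omega) h3
    omega
  rw [e, Int.fract_natCast_add, Int.fract_neg hne]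
  ring

/-- Abel summation. The total of y vanishes by oddness, so its partial sums are controlled from both
ends, which compensates for the growth of the cotangent near 0 and π. -/
theorem abs_sum_cot_mul_fract_le {Z : ℝ}
    (hZ : ∀ n : ℕ, ∑ i ∈ range n, √((i + 1 : ℕ) : ℝ) / ((i + 1 : ℕ) : ℝ) ^ 2 ≤ Z)
    {n M : ℕ} (hM : Nat.fib (n + 1) = M + 1) :
    |∑ j ∈ range M, Real.cos (Real.pi * (j + 1) / (M + 1)) / Real.sin (Real.pi * (j + 1) / (M + 1)) *
      (Int.fract (((j : ℝ) + 1) * (Nat.fib n / Nat.fib (n + 1))) - 1 / 2)| ≤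
      16 * Z * (M + 1) := by
  have hN : (0 : ℝ) < (M : ℝ) + 1 := by positivity
  set x : ℝ := Nat.fib n / Nat.fib (n + 1) with hx
  let y : ℕ → ℝ := fun j => Int.fract (((j : ℝ) + 1) * x) - 1 / 2
  let c : ℕ → ℝ := fun j =>
    Real.cos (Real.pi * (j + 1) / (M + 1)) / Real.sin (Real.pi * (j + 1) / (M + 1))
  change |∑ j ∈ range M, c j • y j| ≤ _
  have G0 : ∑ j ∈ range M, y j = 0 := by
    have h1 := sum_range_reflect y M
    have h2 : ∑ j ∈ range M, y (M - 1 - j) = -∑ j ∈ range M, y j := by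
      rw [← sum_neg_distrib]
      refine sum_congr rfl fun j hj => ?_
      have hcop := Nat.fib_coprime_fib_succ n
      rw [hM] at hcop
      have := fract_sub_half_reflect hcop (mem_range.1 hj)
      simp only [y, hx, hM]
      exact this
    linarith
  have G1 : ∀ m ≤ M, |∑ j ∈ range m, y j| ≤ 9 * √(m : ℝ) := by
    intro m hm
    have := abs_sum_fract_fib_le n m (by omega) x
    have e : ∀ j : ℕ, (j : ℝ) * x + x = ((j : ℝ) + 1) * x := fun j => by ring
    simp only [← hx, e] at this
    exact this
  have G2 : ∀ m ≤ M, |∑ j ∈ range m, y j| ≤ 9 * √((M - m : ℕ) : ℝ) := by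
    intro m hm
    obtain ⟨l, rfl⟩ := Nat.exists_eq_add_of_le hm
    rw [sum_range_add] at G0
    rw [eq_neg_of_add_eq_zero_left G0, abs_neg, Nat.add_sub_cancel_left]
    have := abs_sum_fract_fib_le n l (by omega) ((m + 1) * x)
    have e : ∀ j : ℕ, (j : ℝ) * x + (m + 1) * x = (((m + j : ℕ) : ℝ) + 1) * x := fun j => by
      push_cast; ring
    simp only [← hx, e] at this
    exact this
  rw [sum_range_by_parts, G0, smul_zero, zero_sub, abs_neg]
  refine (abs_sum_le_sum_abs _ _).trans ?_
  have bound : ∀ i ∈ range (M - 1), |(c (i + 1) - c i) • ∑ j ∈ range (i + 1), y j| ≤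
      8 * (M + 1) * (√((min (i + 1) (M - 1 - i) : ℕ) : ℝ) /
        ((min (i + 1) (M - 1 - i) : ℕ) : ℝ) ^ 2) := by
    intro i hi
    have hi := mem_range.1 hi
    set l := min (i + 1) (M - 1 - i) with hl
    have hl1 : 1 ≤ l := by omega
    have hl1' : (1 : ℝ) ≤ l := by exact_mod_cast hl1
    have hl2 : (l : ℝ) ≤ i + 1 := by exact_mod_cast (by omega : l ≤ i + 1)
    have hl3 : (l : ℝ) + i + 2 ≤ M + 1 := by exact_mod_cast (by omega : l + i + 2 ≤ M + 1)
    have hG : |∑ j ∈ range (i + 1), y j| ≤ 9 * √(l : ℝ) := by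
      rcases min_choice (i + 1) (M - 1 - i) with h | h
      · rw [hl, h]; exact G1 _ (by omega)
      · rw [hl, h, show M - 1 - i = M - (i + 1) by omega]; exact G2 _ (by omega)
    have s1 := two_mul_div_le_sin (l := l) (t := i + 1) (N := M + 1) (by positivity) hN hl2
      (by linarith)
    have s2 := two_mul_div_le_sin (l := l) (t := ((i + 1 : ℕ) : ℝ) + 1) (N := M + 1)
      (by positivity) hN (by push_cast; linarith) (by push_cast; linarith)
    have hp : 0 < 2 * (l : ℝ) / (M + 1) := by positivity
    have hs1 := hp.trans_le s1
    have hs2 := hp.trans_le s2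
    have hc : |c (i + 1) - c i| ≤ Real.pi / (M + 1) / (2 * (l : ℝ) / (M + 1)) ^ 2 := by
      -- cot u - cot v = sin(v - u)/(sin u sin v).
      have e : c (i + 1) - c i = -(Real.sin (Real.pi / (M + 1)) /
          (Real.sin (Real.pi * (i + 1) / (M + 1)) *
            Real.sin (Real.pi * (((i + 1 : ℕ) : ℝ) + 1) / (M + 1)))) := by
        have : Real.pi / (M + 1) = Real.pi * (((i + 1 : ℕ) : ℝ) + 1) / (M + 1) -
            Real.pi * (i + 1) / (M + 1) := by push_cast; ring
        rw [this, Real.sin_sub]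
        simp only [c]
        field_simp
        ring
      rw [e, abs_neg, abs_div, abs_of_pos (mul_pos hs1 hs2), sq]
      gcongr
      exact Real.abs_sin_le_abs.trans (abs_of_pos (by positivity)).le
    rw [smul_eq_mul, abs_mul]
    calc _ ≤ Real.pi / (M + 1) / (2 * (l : ℝ) / (M + 1)) ^ 2 * (9 * √(l : ℝ)) := by gcongr
      _ = (9 / 4 * Real.pi) * ((M + 1) * (√(l : ℝ) / (l : ℝ) ^ 2)) := by
        field_simp; ring
      _ ≤ 8 * ((M + 1) * (√(l : ℝ) / (l : ℝ) ^ 2)) := by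
        gcongr
        linarith [Real.pi_lt_d2]
      _ = _ := by ring
  refine (sum_le_sum bound).trans ?_
  rw [← mul_sum]
  calc _ ≤ 8 * ((M : ℝ) + 1) * (2 * Z) := by gcongr; exact sum_sqrt_div_sq_min_le hZ _
    _ = _ := by ring

/-! ### Reordering the factors. -/

theorem abs_sin_pi_mul_neg_one_pow_mul_add_int (k : ℕ) (X : ℝ) (t : ℤ) :
    |Real.sin (Real.pi * ((-1) ^ k * X + t))| = |Real.sin (Real.pi * X)| := by
  rw [mul_add, mul_comm Real.pi (t : ℝ), Real.sin_add_int_mul_pi, abs_mul, abs_zpow, abs_neg,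
    abs_one, one_zpow, one_mul]
  rcases neg_one_pow_eq_or ℝ k with h | h <;> rw [h]
  · rw [one_mul]
  · rw [neg_one_mul, mul_neg, Real.sin_neg, abs_neg]

/-- Cassini's identity gives p² ≡ (-1)^k mod N, so rp/N is (-1)^k (j+1)/N mod 1. The defect of ω
from p/N contributes η r/N with r/N = {(j+1)p/N}; centring this at 1/2 puts η/2 into the constant
shift. -/
theorem abs_sin_fib_rotation (k j : ℕ) (α : ℝ) :
    |2 * Real.sin (Real.pi * ((((j + 1) * Nat.fib (k + 1) % Nat.fib (k + 2) : ℕ) : ℝ) *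
      invGoldenMean + α))| =
    |2 * Real.sin (Real.pi * ((j + 1) / Nat.fib (k + 2) +
      ((-1) ^ k * α - invGoldenMean ^ (k + 2) / 2) - invGoldenMean ^ (k + 2) *
        (Int.fract (((j : ℝ) + 1) * (Nat.fib (k + 1) / Nat.fib (k + 2))) - 1 / 2)))| := by
  have hN : (Nat.fib (k + 2) : ℝ) ≠ 0 := by
    exact_mod_cast (Nat.fib_pos.2 (by omega : 0 < k + 2)).ne'
  have hw := fib_succ_mul_invGoldenMean (k + 1)
  have hc := fib_sq_add_mul_sub_sq (k + 1)
  have hfr : Int.fract (((j : ℝ) + 1) * (Nat.fib (k + 1) / Nat.fib (k + 2))) =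
      (((j + 1) * Nat.fib (k + 1) % Nat.fib (k + 2) : ℕ) : ℝ) / Nat.fib (k + 2) := by
    rw [← Int.fract_div_natCast_eq_div_natCast_mod]
    push_cast
    rw [mul_div_assoc]
  have hd := Nat.mod_add_div ((j + 1) * Nat.fib (k + 1)) (Nat.fib (k + 2))
  rw [hfr]
  rw [show k + 1 + 1 = k + 2 by rfl] at hw hc
  set N := Nat.fib (k + 2)
  set p := Nat.fib (k + 1)
  set r := (j + 1) * p % N
  set d := (j + 1) * p / N
  have hc' : (p : ℝ) ^ 2 + p * N - N ^ 2 = (-1) ^ k := by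
    have : (p : ℝ) ^ 2 + p * N - N ^ 2 = (-1) ^ (k + 2) := by exact_mod_cast hc
    rw [this, pow_add]; norm_num
  have hd' : (r : ℝ) + N * d = (j + 1) * p := by exact_mod_cast hd
  have hs : ((-1 : ℝ) ^ k) * (-1) ^ k = 1 := by rw [← mul_pow]; norm_num
  have hw' : (N : ℝ) * invGoldenMean = p - (-1) ^ k * invGoldenMean ^ (k + 2) := by
    rw [hw, neg_pow, pow_add (-1 : ℝ)]; norm_num
  symm
  rw [abs_mul, abs_mul, ← abs_sin_pi_mul_neg_one_pow_mul_add_int k _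
    (((j : ℤ) + 1) * N - (j + 1) * p - p * d)]
  symm
  congr 4
  generalize invGoldenMean ^ (k + 2) = η at *
  generalize (-1 : ℝ) ^ k = σ at *
  push_cast
  field_simp
  linear_combination 2 * r * hw' + 2 * p * hd' + 2 * ((j : ℝ) + 1) * hc' - 2 * N * α * hs

theorem prod_Icc_eq_prod_mod {p M : ℕ} (h : p.Coprime (M + 1)) (g : ℕ → ℝ) :
    ∏ r ∈ Icc 1 M, g r = ∏ j ∈ range M, g ((j + 1) * p % (M + 1)) := by
  let f : ℕ → ℕ := fun j => (j + 1) * p % (M + 1)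
  have inj : Set.InjOn f (range M) := by
    intro i hi j hj hij
    have h1 : i + 1 ≡ j + 1 [MOD M + 1] := Nat.ModEq.cancel_right_of_coprime h.symm hij
    have hi : i < M := by simpa using hi
    have hj : j < M := by simpa using hj
    have := h1.eq_of_lt_of_lt (by omega) (by omega)
    omega
  have img : (range M).image f = Icc 1 M := by
    apply eq_of_subset_of_card_le
    · intro i hi
      obtain ⟨j, hj, rfl⟩ := mem_image.1 hi
      have hj := mem_range.1 hj
      have h1 : f j < M + 1 := Nat.mod_lt _ (by omega)
      have h2 : f j ≠ 0 := by
        intro h0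
        have h3 := h.symm.dvd_of_dvd_mul_right (Nat.dvd_of_mod_eq_zero h0)
        have := Nat.le_of_dvd (by omega) h3
        omega
      exact mem_Icc.2 ⟨by omega, by omega⟩
    · rw [card_image_of_injOn inj]; simp
  rw [← img, prod_image inj]

/-! ### Assembling the bounds. -/

theorem abs_sin_pi_mul_bounds {e : ℝ} (h : |e| ≤ 0.6181) :
    2 * |e| ≤ |2 * Real.sin (Real.pi * e)| ∧ |2 * Real.sin (Real.pi * e)| ≤ 8 * |e| := by
  wlog he : 0 ≤ e generalizing e
  · have := this (e := -e) (by rwa [abs_neg]) (by linarith)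
    rwa [mul_neg, Real.sin_neg, mul_neg, abs_neg, abs_neg] at this
  have hpi := Real.pi_pos
  rw [abs_of_nonneg he] at h ⊢
  constructor
  · refine le_trans ?_ (le_abs_self _)
    -- e may exceed 1/2, but min(e, 1 - e) ≥ e/2 in this range.
    have := two_mul_div_le_sin (l := min e (1 - e)) (t := e) (N := 1)
      (le_min he (by linarith)) one_pos (min_le_left _ _) (min_le_right _ _)
    rw [div_one, div_one] at this
    rcases min_choice e (1 - e) with h3 | h3 <;> rw [h3] at this <;> linarith
  · rw [abs_mul, abs_two]
    have h1 := Real.abs_sin_le_abs (x := Real.pi * e)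
    rw [abs_of_nonneg (by positivity : 0 ≤ Real.pi * e)] at h1
    nlinarith [Real.pi_lt_four]

/-- 130000 covers 128 from the linear term and 30000·4 from the quadratic errors. -/
theorem prod_abs_sin_sq_bounds {Z : ℝ}
    (hZ : ∀ n : ℕ, ∑ i ∈ range n, √((i + 1 : ℕ) : ℝ) / ((i + 1 : ℕ) : ℝ) ^ 2 ≤ Z)
    {k M : ℕ} (hM : Nat.fib (k + 2) = M + 1) {B : ℝ}
    (hB : |B| ≤ invGoldenMean ^ (k + 3) + invGoldenMean ^ (k + 2) / 2) :
    ((M : ℝ) + 1) ^ 2 * Real.exp (-(130000 * Z)) ≤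
      (∏ j ∈ range M, |2 * Real.sin (Real.pi * ((j + 1) / Nat.fib (k + 2) + B -
        invGoldenMean ^ (k + 2) *
        (Int.fract (((j : ℝ) + 1) * (Nat.fib (k + 1) / Nat.fib (k + 2))) - 1 / 2)))|) ^ 2 ∧
    (∏ j ∈ range M, |2 * Real.sin (Real.pi * ((j + 1) / Nat.fib (k + 2) + B -
        invGoldenMean ^ (k + 2) *
        (Int.fract (((j : ℝ) + 1) * (Nat.fib (k + 1) / Nat.fib (k + 2))) - 1 / 2)))|) ^ 2 ≤
      ((M : ℝ) + 1) ^ 2 * Real.exp (130000 * Z) := by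
  have hpi := Real.pi_pos
  have hw := invGoldenMean_pos
  have hN : (0 : ℝ) < (M : ℝ) + 1 := by positivity
  have hZ0 : 0 ≤ Z := by simpa using hZ 0
  have hsmall := fib_succ_mul_pow_le k
  have hcop := Nat.fib_coprime_fib_succ (k + 1)
  have hcot := abs_sum_cot_mul_fract_le hZ (n := k + 1) hM
  rw [show k + 1 + 1 = k + 2 by rfl, hM] at hcop hcot
  rw [hM] at hsmall ⊢
  set η := invGoldenMean ^ (k + 2) with hη
  have hη0 : 0 < η := by positivity
  set p := Nat.fib (k + 1)
  let y : ℕ → ℝ := fun j => Int.fract (((j : ℝ) + 1) * (p / (M + 1 : ℕ))) - 1 / 2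
  let a : ℕ → ℝ := fun j => Real.pi * (j + 1) / (M + 1)
  let b : ℕ → ℝ := fun j => -(Real.pi * η * y j)
  let c : ℝ := Real.pi * B
  let A : ℕ → ℝ := fun j => |2 * Real.sin (Real.pi * ((j + 1) / (M + 1 : ℕ) + B - η * y j))|
  let R : ℕ → ℝ := fun j =>
    Real.sin (a j + b j + c) * Real.sin (a j + b j - c) / Real.sin (a j) ^ 2
  let s : ℕ → ℝ := fun j => (b j ^ 2 + c ^ 2) / Real.sin (a j) ^ 2
  let v : ℕ → ℝ := fun j => 2 * b j * (Real.cos (a j) / Real.sin (a j))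
  change _ ≤ (∏ j ∈ range M, A j) ^ 2 ∧ (∏ j ∈ range M, A j) ^ 2 ≤ _
  have hbc : ∀ j, |b j| + |c| ≤ 4 / 5 * (Real.pi / (M + 1)) := by
    intro j
    have hy : |y j| ≤ 1 / 2 := by
      have h1 := Int.fract_nonneg (((j : ℝ) + 1) * (p / (M + 1 : ℕ)))
      have h2 := Int.fract_lt_one (((j : ℝ) + 1) * (p / (M + 1 : ℕ)))
      exact abs_le.2 ⟨by simp only [y]; linarith, by simp only [y]; linarith⟩
    have h1 : |b j| ≤ Real.pi * η * (1 / 2) := by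
      simp only [b]
      rw [abs_neg, abs_mul, abs_of_pos (by positivity)]
      gcongr
    have h2 : |c| ≤ Real.pi * (invGoldenMean ^ (k + 3) + η / 2) := by
      simp only [c]
      rw [abs_mul, abs_of_pos hpi]
      gcongr
    -- The bound on B enters here: the total displacement is at most πω^{k+1}, hence at most 4/5 of
    -- the spacing π/N.
    have h3 : invGoldenMean ^ (k + 3) + η = invGoldenMean ^ (k + 1) := by
      rw [hη]
      linear_combination invGoldenMean ^ (k + 1) * invGoldenMean_sq
    calc _ ≤ Real.pi * (invGoldenMean ^ (k + 3) + η) := by linarith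
      _ = Real.pi / (M + 1) * (((M + 1 : ℕ) : ℝ) * invGoldenMean ^ (k + 1)) := by
        rw [h3]; push_cast; field_simp
      _ ≤ Real.pi / (M + 1) * 0.8 := by gcongr
      _ = _ := by ring
  have hj2 : ∀ j ∈ range M, (j : ℝ) + 1 + 1 ≤ M + 1 := fun j hj => by
    exact_mod_cast (by have := mem_range.1 hj; omega : j + 1 + 1 ≤ M + 1)
  have hu : ∀ j, Real.pi / (M + 1) ≤ a j := fun j => by
    simp only [a]
    gcongr
    nlinarith [(Nat.cast_nonneg j : (0 : ℝ) ≤ j)]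
  have hu2 : ∀ j ∈ range M, Real.pi / (M + 1) ≤ Real.pi - a j := fun j hj => by
    have e : Real.pi - a j = Real.pi * (M - j) / (M + 1) := by simp only [a]; field_simp; ring
    rw [e]
    gcongr
    nlinarith [hj2 j hj]
  have hu0 : 0 < Real.pi / ((M : ℝ) + 1) := by positivity
  have hR := fun j hj => sin_mul_sin_div_sq_bounds (a := a j) (b := b j) (c := c)
    (hu0.trans_le (hu j)) (by linarith [hu2 j hj])
    ((hbc j).trans (by linarith [hu j])) ((hbc j).trans (by linarith [hu2 j hj]))
  have hS : ∀ j ∈ range M, 0 < Real.sin (a j) := fun j hj =>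
    Real.sin_pos_of_pos_of_lt_pi (hu0.trans_le (hu j)) (by linarith [hu2 j hj])
  have hRpos : ∀ j ∈ range M, 0 < R j := fun j hj => (Real.exp_pos _).trans_le (hR j hj).1
  have hAA : ∀ j ∈ range M, A j * A (M - 1 - j) = (2 * Real.sin (a j)) ^ 2 * R j := by
    intro j hj
    have e1 : A j = |2 * Real.sin (a j + b j + c)| := by
      simp only [A, a, b, c]
      congr 3
      push_cast
      ring
    have hjM := mem_range.1 hj
    have e2 : A (M - 1 - j) = |2 * Real.sin (a j + b j - c)| := by
      have hy : y (M - 1 - j) = -y j := fract_sub_half_reflect hcop hjM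
      have hc : ((M - 1 - j : ℕ) : ℝ) = M - 1 - j := by
        rw [Nat.cast_sub (by omega), Nat.cast_sub (by omega)]; simp
      simp only [A, hy, hc, a, b, c]
      rw [← Real.sin_pi_sub]
      congr 3
      push_cast
      field_simp
      ring
    have h0 := (hS j hj).ne'
    rw [e1, e2, ← abs_mul]
    have e3 : 2 * Real.sin (a j + b j + c) * (2 * Real.sin (a j + b j - c)) =
        (2 * Real.sin (a j)) ^ 2 * R j := by
      simp only [R]; field_simp
    rw [e3, abs_of_nonneg]
    have := hRpos j hj
    positivity
  have hP : (∏ j ∈ range M, A j) ^ 2 = ((M : ℝ) + 1) ^ 2 * ∏ j ∈ range M, R j := by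
    rw [sq]
    -- Reversing one copy of the product pairs each factor with its mirror image.
    nth_rw 2 [← prod_range_reflect]
    rw [← prod_mul_distrib, prod_congr rfl hAA, prod_mul_distrib, prod_pow]
    congr 2
    exact prod_two_sin M
  have hsum_s : ∑ j ∈ range M, s j ≤ 4 * Z := by
    have : ∀ j ∈ range M, s j ≤ 2 * (√((min (j + 1) (M - j) : ℕ) : ℝ) /
        ((min (j + 1) (M - j) : ℕ) : ℝ) ^ 2) := by
      intro j hj
      have hjM := mem_range.1 hj
      set l := min (j + 1) (M - j) with hl
      have hl1 : (1 : ℝ) ≤ l := by exact_mod_cast (by omega : 1 ≤ l)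
      have hl2 : (l : ℝ) ≤ j + 1 := by exact_mod_cast (by omega : l ≤ j + 1)
      have hl3 : (l : ℝ) + j ≤ M := by exact_mod_cast (by omega : l + j ≤ M)
      have s1 : 2 * (l : ℝ) / (M + 1) ≤ Real.sin (a j) :=
        two_mul_div_le_sin (by positivity) hN hl2 (by linarith)
      have h1 : b j ^ 2 + c ^ 2 ≤ (4 / 5 * (Real.pi / (M + 1))) ^ 2 := by
        have h2 := hbc j
        have h3 : (|b j| + |c|) ^ 2 ≤ (4 / 5 * (Real.pi / (M + 1))) ^ 2 := by gcongr
        rw [← sq_abs (b j), ← sq_abs c]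
        nlinarith [abs_nonneg (b j), abs_nonneg c]
      calc s j ≤ (4 / 5 * (Real.pi / (M + 1))) ^ 2 / (2 * (l : ℝ) / (M + 1)) ^ 2 := by
            simp only [s]; gcongr
        _ = 4 / 25 * Real.pi ^ 2 * (1 / (l : ℝ) ^ 2) := by field_simp; ring
        _ ≤ 2 * (√(l : ℝ) / (l : ℝ) ^ 2) := by
            gcongr
            · nlinarith [Real.pi_lt_d2]
            · exact Real.one_le_sqrt.2 hl1
    refine (sum_le_sum this).trans ?_
    rw [← mul_sum]
    linarith [sum_sqrt_div_sq_min_le hZ M]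
  have hsum_v : |∑ j ∈ range M, v j| ≤ 128 * Z := by
    have e : ∑ j ∈ range M, v j = -(2 * Real.pi * η) *
        ∑ j ∈ range M, Real.cos (a j) / Real.sin (a j) * y j := by
      rw [mul_sum]
      refine sum_congr rfl fun j _ => ?_
      simp only [v, b]
      ring
    rw [e, abs_mul, abs_neg, abs_of_pos (by positivity)]
    have h1 : ((M : ℝ) + 1) * η ≤ 1 := by
      have : ((M : ℝ) + 1) * η = ((M + 1 : ℕ) : ℝ) * invGoldenMean ^ (k + 1) * invGoldenMean := by
        rw [hη]; push_cast; ring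
      rw [this]
      have := mul_le_mul_of_nonneg_right hsmall hw.le
      linarith [invGoldenMean_lt]
    calc _ ≤ 2 * Real.pi * η * (16 * Z * (M + 1)) := by gcongr
      _ = Real.pi * (32 * Z) * ((M + 1) * η) := by ring
      _ ≤ 4 * (32 * Z) * 1 := by
        gcongr
        exact Real.pi_lt_four.le
      _ = _ := by ring
  have hv := abs_le.1 hsum_v
  rw [hP]
  constructor
  · gcongr
    calc _ ≤ Real.exp (∑ j ∈ range M, (v j - 30000 * s j)) := by
          rw [sum_sub_distrib, ← mul_sum]
          gcongr
          linarith
      _ ≤ _ := by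
          rw [Real.exp_sum]
          exact prod_le_prod (fun j _ => (Real.exp_pos _).le) fun j hj => (hR j hj).1
  · gcongr
    calc _ ≤ Real.exp (∑ j ∈ range M, (v j + 30000 * s j)) := by
          rw [Real.exp_sum]
          exact prod_le_prod (fun j hj => (hRpos j hj).le) fun j hj => (hR j hj).2
      _ ≤ _ := by
          rw [sum_add_distrib, ← mul_sum]
          gcongr
          linarith

theorem mainTheorem3 :
    ∃ C₁ C₂ : ℝ, 0 < C₁ ∧ C₁ ≤ 1 ∧ 1 ≤ C₂ ∧
      ∀ (n : ℕ) (α : ℝ), 2 ≤ n → |α| ≤ invGoldenMean ^ (n + 1) →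
        C₁ ≤ shiftedSineProd (Nat.fib n) α ∧ shiftedSineProd (Nat.fib n) α ≤ C₂ := by
  obtain ⟨Z, hZ⟩ := exists_sum_sqrt_div_sq_le
  have hZ0 : 0 ≤ Z := by simpa using hZ 0
  set L := 130000 * Z with hL
  have hL0 : 0 ≤ L := by positivity
  have hexp : 1 ≤ Real.exp L := Real.one_le_exp hL0
  have hexp' : Real.exp (-L) ≤ 1 := Real.exp_le_one_iff.2 (by linarith)
  have hpos := Real.exp_pos (-L)
  refine ⟨0.2 * Real.exp (-L), 8 * Real.exp L, by positivity, by linarith, by linarith, ?_⟩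
  intro n α hn hα
  obtain ⟨k, rfl⟩ := Nat.exists_eq_add_of_le' hn
  rw [show k + 2 + 1 = k + 3 by rfl] at hα
  have hw := invGoldenMean_pos
  have hwlt := invGoldenMean_lt
  have hwgt := invGoldenMean_gt
  have hw2 := invGoldenMean_sq
  have hfib := Nat.fib_pos.2 (by omega : 0 < k + 2)
  obtain ⟨M, hM⟩ : ∃ M, Nat.fib (k + 2) = M + 1 := ⟨_, (Nat.sub_add_cancel hfib).symm⟩
  have hcop := Nat.fib_coprime_fib_succ (k + 1)
  have hsign : |(-1 : ℝ) ^ k| = 1 := by simp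
  have hB : |(-1) ^ k * α - invGoldenMean ^ (k + 2) / 2| ≤
      invGoldenMean ^ (k + 3) + invGoldenMean ^ (k + 2) / 2 := by
    refine (abs_sub _ _).trans ?_
    rw [abs_mul, hsign, one_mul, abs_of_pos (by positivity : 0 < invGoldenMean ^ (k + 2) / 2)]
    linarith
  obtain ⟨P1, P2⟩ := prod_abs_sin_sq_bounds hZ hM hB
  simp_rw [← abs_sin_fib_rotation] at P1 P2
  have hge := fib_succ_mul_pow_ge k
  have hle := fib_succ_mul_pow_le k
  have hlast := fib_succ_mul_invGoldenMean (k + 1)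
  rw [show k + 1 + 1 = k + 2 by rfl] at hcop hlast
  rw [hM] at P1 P2 hge hle hlast hcop ⊢
  rw [← prod_Icc_eq_prod_mod hcop
    (fun r => |2 * Real.sin (Real.pi * ((r : ℝ) * invGoldenMean + α))|)] at P1 P2
  unfold shiftedSineProd
  rw [prod_Icc_succ_top (by omega), hlast]
  set P := ∏ r ∈ Icc 1 M, |2 * Real.sin (Real.pi * ((r : ℝ) * invGoldenMean + α))|
  have hP0 : 0 ≤ P := prod_nonneg fun _ _ => abs_nonneg _
  have hN : (0 : ℝ) < (M : ℝ) + 1 := by positivity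
  -- As exp(-L) ≤ 1, its square is at most itself, so L need not be halved.
  have P1' : ((M : ℝ) + 1) * Real.exp (-L) ≤ P := by
    rw [← sq_le_sq₀ (by positivity) hP0, mul_pow]
    refine le_trans ?_ P1
    gcongr
    nlinarith
  have P2' : P ≤ ((M : ℝ) + 1) * Real.exp L := by
    rw [← sq_le_sq₀ hP0 (by positivity), mul_pow]
    refine P2.trans ?_
    gcongr
    nlinarith
  set e := α - (-invGoldenMean) ^ (k + 2) with he
  have hE : |2 * Real.sin (Real.pi * ((Nat.fib (k + 1) : ℝ) - (-invGoldenMean) ^ (k + 2) + α))| =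
      |2 * Real.sin (Real.pi * e)| := by
    rw [abs_mul, abs_mul]
    congr 1
    have := abs_sin_pi_mul_neg_one_pow_mul_add_int 0 e (Nat.fib (k + 1))
    rw [← this, he]
    congr 3
    push_cast
    ring
  rw [hE]
  have habs : |(-invGoldenMean) ^ (k + 2)| = invGoldenMean ^ (k + 2) := by
    rw [abs_pow, abs_neg, abs_of_pos hw]
  have he1 : |e| ≤ invGoldenMean ^ (k + 1) := by
    refine (abs_sub _ _).trans ?_
    rw [habs]
    linarith [show invGoldenMean ^ (k + 3) + invGoldenMean ^ (k + 2) = invGoldenMean ^ (k + 1) by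
      linear_combination invGoldenMean ^ (k + 1) * hw2]
  -- The last factor cannot vanish: |α| ≤ ω^{k+3}, while Nω lies at distance ω^{k+2} from an
  -- integer.
  have he2 : invGoldenMean ^ (k + 4) ≤ |e| := by
    have := abs_sub_abs_le_abs_sub ((-invGoldenMean) ^ (k + 2)) α
    rw [habs, abs_sub_comm] at this
    linarith [show invGoldenMean ^ (k + 4) = invGoldenMean ^ (k + 2) - invGoldenMean ^ (k + 3) by
      linear_combination invGoldenMean ^ (k + 2) * hw2]
  have he3 : invGoldenMean ^ (k + 1) ≤ 0.6181 := by
    calc invGoldenMean ^ (k + 1) ≤ invGoldenMean ^ 1 :=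
          pow_le_pow_of_le_one hw.le (by linarith) (by omega)
      _ ≤ _ := by rw [pow_one]; exact hwlt.le
  obtain ⟨E1, E2⟩ := abs_sin_pi_mul_bounds (he1.trans he3)
  set E := |2 * Real.sin (Real.pi * e)|
  push_cast at hge hle
  -- From E ≥ 2ω^{k+4} and Nω^{k+1} ≥ ω, the product is at least 2ω⁴ > 0.2.
  have low : 0.2 ≤ ((M : ℝ) + 1) * E := by
    calc (0.2 : ℝ) ≤ 2 * (invGoldenMean ^ 3 * invGoldenMean) := by
          rw [show invGoldenMean ^ 3 * invGoldenMean = (invGoldenMean ^ 2) ^ 2 by ring, hw2]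
          nlinarith
      _ ≤ 2 * (invGoldenMean ^ 3 * (((M : ℝ) + 1) * invGoldenMean ^ (k + 1))) := by gcongr
      _ = ((M : ℝ) + 1) * (2 * invGoldenMean ^ (k + 4)) := by ring
      _ ≤ _ := by gcongr; linarith
  have high : ((M : ℝ) + 1) * E ≤ 8 := by
    calc _ ≤ ((M : ℝ) + 1) * (8 * invGoldenMean ^ (k + 1)) := by gcongr; linarith
      _ ≤ 8 := by linarith
  have hE0 : 0 ≤ E := abs_nonneg _
  constructor
  · calc _ ≤ ((M : ℝ) + 1) * E * Real.exp (-L) := by gcongr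
      _ = ((M : ℝ) + 1) * Real.exp (-L) * E := by ring
      _ ≤ _ := by gcongr
  · calc _ ≤ ((M : ℝ) + 1) * Real.exp L * E := by gcongr
      _ = ((M : ℝ) + 1) * E * Real.exp L := by ring
      _ ≤ _ := by gcongr
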